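/- Let $N\ge 2$ and let $\Omega\subset\mathbb{R}^N$ be a bounded domain (non-empty, open, connected) with strong Lipschitz boundary $\Gamma:=\partial\Omega$, i.e. every boundary point has a neighbourhood in which, in suitable orthonormal coordinates, $\Omega$ is the set of points lying strictly below the graph of a Lipschitz function. Let $\Gamma_{\mathsf t}\subset\Gamma$ be relatively open and $\Gamma_{\mathsf n}:=\Gamma\setminus\overline{\Gamma_{\mathsf t}}$. Let $\nu$ be the outer unit normal, defined a.e. on $\Gamma$ with respect to the $(N-1)$-dimensional surface measure, and for a vector field $v$ put $v_{\mathsf n}:=\nu\cdot v|_\Gamma$ and $v_{\mathsf t}:=v|_\Gamma-v_{\mathsf n}\nu$. Let $\mathsf H^1_{\mathsf{t,n}}(\Omega)$ be the closure in $\mathsf H^1(\Omega)=\mathsf H^1(\Omega;\mathbb{R}^N)$ of $$\{v|_\Omega : v\in C_c^\infty(\mathbb{R}^N;\mathbb{R}^N),\ v_{\mathsf t}=0 \text{ a.e. on } \Gamma_{\mathsf t},\ v_{\mathsf n}=0 \text{ a.e. on } \Gamma_{\mathsf n}\}.$$ For $v\in\mathsf H^1(\Omega)$ let $\nabla v$ be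 the matrix field $(\partial_i v_j)_{i,j}$ of weak derivatives; $\|\cdot\|$ is the $\mathsf L^2(\Omega)$-norm (with the Euclidean norm on vectors and the Frobenius norm on matrices), and $\perp$ is orthogonality in $\mathsf L^2(\Omega)$. Let $\mathsf H^1_{\mathsf{t,n}}(\Omega)\cap\mathbb{R}^N$ denote the space of constant vector fields that lie in $\mathsf H^1_{\mathsf{t,n}}(\Omega)$. (a) There exists $c>0$ such that for all $v\in\mathsf H^1_{\mathsf{t,n}}(\Omega)\cap\big(\mathsf H^1_{\mathsf{t,n}}(\Omega)\cap\mathbb{R}^N\big)^\perp$, $$\|v\|\le c\,\|\nabla v\|.$$ (b) $\nabla\mathsf H^1_{\mathsf{t,n}}(\Omega)=\{\nabla v : v\in\mathsf H^1_{\mathsf{t,n}}(\Omega)\}$ is a closed subspace of $\mathsf L^2(\Omega)$ (the space of square-integrable matrix fields). -/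

import Mathlib

open MeasureTheory Set Filter Topology
open scoped ContDiff InnerProductSpace

noncomputable section

namespace KornPoincare

/-- The Euclidean space `ℝ^N`. -/
abbrev E (N : ℕ) : Type := EuclideanSpace ℝ (Fin N)

/-- `N × N` matrices with the Frobenius norm. The gradient of a vector field `v` is the matrix
with entries `(i, j) ↦ ∂_i v_j`, i.e. the transpose of the Jacobian of `v`. -/
abbrev Mat (N : ℕ) : Type := EuclideanSpace ℝ (Fin N × Fin N)

variable {N : ℕ}

/-! ### Domains, boundary, normal -/

/-- `Ω` has a strong Lipschitz boundary: near each boundary point, `Ω` is, in suitable orthonormal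
coordinates (with last coordinate direction `e`), the strict subgraph of a Lipschitz function `h`
of the coordinates orthogonal to `e`. -/
def HasStrongLipschitzBoundary (Ω : Set (E N)) : Prop :=
  ∀ p ∈ frontier Ω, ∃ U : Set (E N), IsOpen U ∧ p ∈ U ∧ ∃ e : E N, ‖e‖ = 1 ∧
    ∃ (K : NNReal) (h : (ℝ ∙ e)ᗮ → ℝ), LipschitzWith K h ∧
      ∀ y ∈ U, y ∈ Ω ↔ ⟪e, y⟫_ℝ < h ((ℝ ∙ e)ᗮ.orthogonalProjectionOnto y)

/-- A bounded domain (non-empty, open, connected) with strong Lipschitz boundary. -/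
structure IsBoundedLipschitzDomain (Ω : Set (E N)) : Prop where
  isOpen : IsOpen Ω
  isConnected : IsConnected Ω
  isBounded : Bornology.IsBounded Ω
  lipschitz : HasStrongLipschitzBoundary Ω

/-- `n` is the outer unit normal to `Ω` at `x`: the hyperplane through `x` orthogonal to the unit
vector `n` is tangent to the boundary at `x`, with `Ω` on the side of `-n` and the complement of
`Ω` on the side of `n`. For a Lipschitz subgraph this holds exactly at the points over which the
function is differentiable, with `n` the usual normalized vector `(-∇h, 1)`. -/
def IsOuterUnitNormal (Ω : Set (E N)) (x n : E N) : Prop :=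
  ‖n‖ = 1 ∧ ∀ ε > 0, ∀ᶠ y in 𝓝 x,
    (⟪n, y - x⟫_ℝ < -ε * ‖y - x‖ → y ∈ Ω) ∧ (ε * ‖y - x‖ < ⟪n, y - x⟫_ℝ → y ∉ Ω)

/-- The outer unit normal is unique where it exists. -/
theorem IsOuterUnitNormal.unique {Ω : Set (E N)} {x n m : E N}
    (hn : IsOuterUnitNormal Ω x n) (hm : IsOuterUnitNormal Ω x m) : n = m := by
  by_contra hne
  have hlt : ⟪n, m⟫_ℝ < 1 :=
    lt_of_le_of_ne (by simpa [hn.1, hm.1] using real_inner_le_norm n m)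
      fun h => hne ((inner_eq_one_iff_of_norm_eq_one hn.1 hm.1).1 h)
  set d : E N := m - n with hd
  set δ : ℝ := 1 - ⟪n, m⟫_ℝ with hδ
  have hδ0 : 0 < δ := by simp only [hδ]; linarith
  have hnd : ⟪n, d⟫_ℝ = -δ := by
    rw [hd, inner_sub_right, real_inner_self_eq_norm_sq, hn.1, hδ]; ring
  have hmd : ⟪m, d⟫_ℝ = δ := by
    rw [hd, inner_sub_right, real_inner_self_eq_norm_sq, hm.1, real_inner_comm, hδ]; ring
  have hε : 0 < δ / (2 * (‖d‖ + 1)) := by positivity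
  have hεd : δ / (2 * (‖d‖ + 1)) * ‖d‖ < δ := by
    rw [div_mul_eq_mul_div, div_lt_iff₀ (by positivity)]
    nlinarith [norm_nonneg d]
  have hev := (hn.2 _ hε).and (hm.2 _ hε)
  have htend : Tendsto (fun t : ℝ => x + t • d) (𝓝[>] 0) (𝓝 x) := by
    have : Tendsto (fun t : ℝ => x + t • d) (𝓝 0) (𝓝 (x + (0 : ℝ) • d)) :=
      Continuous.tendsto (by fun_prop) 0
    simpa using this.mono_left nhdsWithin_le_nhds
  obtain ⟨t, ⟨⟨h1, -⟩, -, h2⟩, ht⟩ := ((htend.eventually hev).and self_mem_nhdsWithin).exists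
  have ht' : 0 < t := ht
  simp only [add_sub_cancel_left, inner_smul_right, norm_smul, Real.norm_eq_abs,
    abs_of_pos ht', hnd, hmd] at h1 h2
  refine h2 ?_ (h1 ?_) <;> nlinarith

open Classical in
/-- The outer unit normal field `ν` (with value `0` at the points without a normal, which form a
null set of the boundary when that boundary is Lipschitz). -/
def outerNormal (Ω : Set (E N)) (x : E N) : E N :=
  if h : ∃ n, IsOuterUnitNormal Ω x n then h.choose else 0

/-- The normal component `v_n = ν ⬝ v`. -/
def normalComp (Ω : Set (E N)) (v : E N → E N) (x : E N) : ℝ :=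
  ⟪outerNormal Ω x, v x⟫_ℝ

/-- The tangential component `v_t = v - v_n ν`. -/
def tangentialComp (Ω : Set (E N)) (v : E N → E N) (x : E N) : E N :=
  v x - normalComp Ω v x • outerNormal Ω x

/-- The surface measure: the `(N-1)`-dimensional Hausdorff measure (used only through its null
sets, so its normalization is irrelevant). -/
def surfaceMeasure (N : ℕ) : Measure (E N) := μH[(N : ℝ) - 1]

/-- `Γt` is a relatively open subset of the boundary of `Ω`. -/
def IsRelOpenInBoundary (Ω Γt : Set (E N)) : Prop :=
  ∃ U : Set (E N), IsOpen U ∧ Γt = U ∩ frontier Ω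

/-- The complementary boundary part `Γ_n = Γ \ closure Γ_t`. -/
def normalPart (Ω Γt : Set (E N)) : Set (E N) := frontier Ω \ closure Γt

/-- `v ∈ C_c^∞(ℝ^N; ℝ^N)` with `v_t = 0` a.e. on `Γ_t` and `v_n = 0` a.e. on `Γ_n`. -/
structure IsTestField (Ω Γt : Set (E N)) (v : E N → E N) : Prop where
  smooth : ContDiff ℝ ∞ v
  compact : HasCompactSupport v
  tangential : ∀ᵐ x ∂(surfaceMeasure N).restrict Γt, tangentialComp Ω v x = 0
  normal : ∀ᵐ x ∂(surfaceMeasure N).restrict (normalPart Ω Γt), normalComp Ω v x = 0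

theorem IsTestField.zero (Ω Γt : Set (E N)) : IsTestField Ω Γt (fun _ => 0) where
  smooth := contDiff_const
  compact := HasCompactSupport.zero
  tangential := by simp [tangentialComp, normalComp]
  normal := by simp [normalComp]

theorem IsTestField.add {Ω Γt : Set (E N)} {v w : E N → E N}
    (hv : IsTestField Ω Γt v) (hw : IsTestField Ω Γt w) :
    IsTestField Ω Γt (fun x => v x + w x) where
  smooth := hv.smooth.add hw.smooth
  compact := hv.compact.add hw.compact
  tangential := by
    filter_upwards [hv.tangential, hw.tangential] with x h1 h2
    simp only [tangentialComp, normalComp] at h1 h2 ⊢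
    rw [inner_add_right, add_smul, add_sub_add_comm, h1, h2, add_zero]
  normal := by
    filter_upwards [hv.normal, hw.normal] with x h1 h2
    simp only [normalComp] at h1 h2 ⊢
    rw [inner_add_right, h1, h2, add_zero]

theorem IsTestField.smul {Ω Γt : Set (E N)} {v : E N → E N} (c : ℝ)
    (hv : IsTestField Ω Γt v) : IsTestField Ω Γt (fun x => c • v x) where
  smooth := hv.smooth.const_smul c
  compact := hv.compact.smul_left (f := fun _ => c)
  tangential := by
    filter_upwards [hv.tangential] with x h1
    simp only [tangentialComp, normalComp] at h1 ⊢
    rw [inner_smul_right, mul_smul, ← smul_sub, h1, smul_zero]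
  normal := by
    filter_upwards [hv.normal] with x h1
    simp only [normalComp] at h1 ⊢
    rw [inner_smul_right, h1, mul_zero]

/-! ### Lebesgue and Sobolev spaces -/

/-- Square-integrable vector fields on `Ω`. -/
abbrev L2Vec (Ω : Set (E N)) : Type := Lp (E N) 2 (volume.restrict Ω)

/-- Square-integrable matrix fields on `Ω`. -/
abbrev L2Mat (Ω : Set (E N)) : Type := Lp (Mat N) 2 (volume.restrict Ω)

/-- Scalar test functions `φ ∈ C_c^∞(Ω)`. -/
structure IsTestFunction (Ω : Set (E N)) (φ : E N → ℝ) : Prop where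
  smooth : ContDiff ℝ ∞ φ
  compact : HasCompactSupport φ
  support : tsupport φ ⊆ Ω

/-- The partial derivative `∂_i φ`. -/
def partialDeriv (i : Fin N) (φ : E N → ℝ) (x : E N) : ℝ :=
  fderiv ℝ φ x (EuclideanSpace.single i 1)

/-- `G` is the weak gradient of `v` on `Ω`: `G_{ij} = ∂_i v_j` in the sense of distributions. -/
def IsWeakGradient (Ω : Set (E N)) (v : E N → E N) (G : E N → Mat N) : Prop :=
  ∀ φ : E N → ℝ, IsTestFunction Ω φ → ∀ i j : Fin N,
    ∫ x in Ω, v x j * partialDeriv i φ x = -∫ x in Ω, G x (i, j) * φ x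

theorem IsTestFunction.memLp {Ω : Set (E N)} {φ : E N → ℝ} (hφ : IsTestFunction Ω φ) :
    MemLp φ 2 (volume.restrict Ω) :=
  (hφ.smooth.continuous.memLp_of_hasCompactSupport hφ.compact).restrict Ω

theorem IsTestFunction.memLp_partialDeriv {Ω : Set (E N)} {φ : E N → ℝ}
    (hφ : IsTestFunction Ω φ) (i : Fin N) :
    MemLp (partialDeriv i φ) 2 (volume.restrict Ω) := by
  have hc : Continuous (partialDeriv i φ) :=
    (hφ.smooth.continuous_fderiv (by simp)).clm_apply continuous_const
  have hs : HasCompactSupport (partialDeriv i φ) := hφ.compact.fderiv_apply ℝ _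
  exact (hc.memLp_of_hasCompactSupport hs).restrict Ω

theorem integrable_coord_mul {ι : Type} [Fintype ι] {μ : Measure (E N)}
    (f : Lp (EuclideanSpace ℝ ι) 2 μ) (k : ι) {g : E N → ℝ} (hg : MemLp g 2 μ) :
    Integrable (fun x => f x k * g x) μ := by
  have h : MemLp (fun x => f x k) 2 μ :=
    (Lp.memLp f).continuousLinearMap_comp (EuclideanSpace.proj (𝕜 := ℝ) k)
  exact h.integrable_mul hg

/-- The vector-valued Sobolev space `H¹(Ω)`, as the space of pairs `(v, ∇v)` with the norm
`(‖v‖² + ‖∇v‖²)^{1/2}`. -/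
def H1 (Ω : Set (E N)) : Submodule ℝ (WithLp 2 (L2Vec Ω × L2Mat Ω)) where
  carrier := {w | IsWeakGradient Ω w.fst w.snd}
  zero_mem' := by
    intro φ _ i j
    have h1 : ∀ᵐ x ∂volume.restrict Ω,
        ((0 : L2Vec Ω) : E N → E N) x j * partialDeriv i φ x = 0 := by
      filter_upwards [Lp.coeFn_zero (E N) 2 (volume.restrict Ω)] with x hx
      rw [hx, Pi.zero_apply, PiLp.zero_apply, zero_mul]
    have h2 : ∀ᵐ x ∂volume.restrict Ω,
        ((0 : L2Mat Ω) : E N → Mat N) x (i, j) * φ x = 0 := by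
      filter_upwards [Lp.coeFn_zero (Mat N) 2 (volume.restrict Ω)] with x hx
      rw [hx, Pi.zero_apply, PiLp.zero_apply, zero_mul]
    simp only [WithLp.zero_fst, WithLp.zero_snd]
    rw [integral_eq_zero_of_ae h1, integral_eq_zero_of_ae h2, neg_zero]
  add_mem' := by
    intro a b ha hb φ hφ i j
    have h1 : (fun x => (a + b).fst x j * partialDeriv i φ x) =ᵐ[volume.restrict Ω]
        fun x => a.fst x j * partialDeriv i φ x + b.fst x j * partialDeriv i φ x := by
      filter_upwards [Lp.coeFn_add a.fst b.fst] with x hx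
      rw [WithLp.add_fst, hx, Pi.add_apply, PiLp.add_apply, add_mul]
    have h2 : (fun x => (a + b).snd x (i, j) * φ x) =ᵐ[volume.restrict Ω]
        fun x => a.snd x (i, j) * φ x + b.snd x (i, j) * φ x := by
      filter_upwards [Lp.coeFn_add a.snd b.snd] with x hx
      rw [WithLp.add_snd, hx, Pi.add_apply, PiLp.add_apply, add_mul]
    rw [integral_congr_ae h1, integral_congr_ae h2,
      integral_add (integrable_coord_mul _ _ (hφ.memLp_partialDeriv i))
        (integrable_coord_mul _ _ (hφ.memLp_partialDeriv i)),
      integral_add (integrable_coord_mul _ _ hφ.memLp) (integrable_coord_mul _ _ hφ.memLp),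
      ha φ hφ i j, hb φ hφ i j, neg_add]
  smul_mem' := by
    intro c a ha φ hφ i j
    have h1 : (fun x => (c • a).fst x j * partialDeriv i φ x) =ᵐ[volume.restrict Ω]
        fun x => c * (a.fst x j * partialDeriv i φ x) := by
      filter_upwards [Lp.coeFn_smul c a.fst] with x hx
      simp [WithLp.smul_fst, hx, mul_assoc]
    have h2 : (fun x => (c • a).snd x (i, j) * φ x) =ᵐ[volume.restrict Ω]
        fun x => c * (a.snd x (i, j) * φ x) := by
      filter_upwards [Lp.coeFn_smul c a.snd] with x hx
      simp [WithLp.smul_snd, hx, mul_assoc]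
    rw [integral_congr_ae h1, integral_congr_ae h2, integral_const_mul, integral_const_mul,
      ha φ hφ i j, mul_neg]

/-- The field `v ∈ L²(Ω)` underlying an element of `H¹(Ω)`. -/
def field (Ω : Set (E N)) : H1 Ω →ₗ[ℝ] L2Vec Ω :=
  WithLp.fstₗ 2 ℝ (L2Vec Ω) (L2Mat Ω) ∘ₗ (H1 Ω).subtype

/-- The gradient `∇ : H¹(Ω) → L²(Ω)`. -/
def grad (Ω : Set (E N)) : H1 Ω →ₗ[ℝ] L2Mat Ω :=
  WithLp.sndₗ 2 ℝ (L2Vec Ω) (L2Mat Ω) ∘ₗ (H1 Ω).subtype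

/-- The restrictions to `Ω` of the test fields, as elements of `H¹(Ω)`. -/
def testFields (Ω Γt : Set (E N)) : Submodule ℝ (H1 Ω) where
  carrier := {w | ∃ v : E N → E N, IsTestField Ω Γt v ∧ field Ω w =ᵐ[volume.restrict Ω] v}
  zero_mem' := ⟨_, IsTestField.zero Ω Γt, by
    rw [map_zero]; exact Lp.coeFn_zero (E N) 2 (volume.restrict Ω)⟩
  add_mem' := by
    rintro a b ⟨v, hv, hav⟩ ⟨w, hw, hbw⟩
    refine ⟨_, hv.add hw, ?_⟩
    rw [map_add]
    filter_upwards [Lp.coeFn_add (field Ω a) (field Ω b), hav, hbw] with x h h1 h2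
    rw [h, Pi.add_apply, h1, h2]
  smul_mem' := by
    rintro c a ⟨v, hv, hav⟩
    refine ⟨_, hv.smul c, ?_⟩
    rw [map_smul]
    filter_upwards [Lp.coeFn_smul c (field Ω a), hav] with x h h1
    rw [h, Pi.smul_apply, h1]

/-- `H¹_{t,n}(Ω)`: the closure in `H¹(Ω)` of the test fields. -/
def H1tn (Ω Γt : Set (E N)) : Submodule ℝ (H1 Ω) :=
  (testFields Ω Γt).topologicalClosure

/-- The constant vector fields on `Ω`, as a subspace of `L²(Ω)`. -/
def constFields (Ω : Set (E N)) : Submodule ℝ (L2Vec Ω) where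
  carrier := {f | ∃ a : E N, f =ᵐ[volume.restrict Ω] fun _ => a}
  zero_mem' := ⟨0, Lp.coeFn_zero (E N) 2 (volume.restrict Ω)⟩
  add_mem' := by
    rintro f g ⟨a, ha⟩ ⟨b, hb⟩
    refine ⟨a + b, ?_⟩
    filter_upwards [Lp.coeFn_add f g, ha, hb] with x h h1 h2
    rw [h, Pi.add_apply, h1, h2]
  smul_mem' := by
    rintro c f ⟨a, ha⟩
    refine ⟨c • a, ?_⟩
    filter_upwards [Lp.coeFn_smul c f, ha] with x h h1
    rw [h, Pi.smul_apply, h1]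

/-- `H¹_{t,n}(Ω) ∩ ℝ^N`, as a subspace of `L²(Ω)`. -/
def H1tnConst (Ω Γt : Set (E N)) : Submodule ℝ (L2Vec Ω) :=
  (H1tn Ω Γt).map (field Ω) ⊓ constFields Ω

end KornPoincare

end

noncomputable section

namespace KornPoincare

open scoped NNReal ENNReal

variable {N : ℕ}

/-! The proof rests on a Poincaré inequality modulo constants, proved by hand for `C¹` fields,
followed by functional analysis; Rellich compactness is not used.

If the segments from `y` to `y + z`, `y ∈ A`, stay in `Ω`, then `v (y + z) - v y` is controlled in
L² over `A` by the derivative on `Ω` (`setLIntegral_increment_le`). Averaging over `z` gives the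
inequality on balls. Near a boundary point, the subgraph condition allows a fixed downward shift
into an interior ball without leaving `Ω`. Finitely many such pieces cover `Ω`, overlapping pieces
can be glued (`PoincareOn.union`), and connectedness makes the gluing reach all of `Ω`. The
inequality passes to the closure `H1tn` because the distance to the constants and the gradient norm
are continuous in `H1`.

It remains to replace all constants by those lying in `H1tn`. With `f` the embedding into L², `g`
the gradient and `F` the finite-dimensional space of constants, `x ↦ (proj_F (f x), g x)` is bounded
below. Hence its range is closed, and so is that of `g`, which is (b). On the part of `H1tn` whose
fields are orthogonal to the admissible constants, `g` is injective with the same closed range, so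
its inverse is bounded, which is (a). -/

/-! ### Increments of a smooth field along segments. -/

theorem enorm_sub_sq_le {F : Type*} [SeminormedAddCommGroup F] (a b c : F) :
    ‖a - c‖ₑ ^ 2 ≤ 2 * (‖a - b‖ₑ ^ 2 + ‖b - c‖ₑ ^ 2) := by
  have h : ‖a - c‖₊ ^ 2 ≤ 2 * (‖a - b‖₊ ^ 2 + ‖b - c‖₊ ^ 2) :=
    (pow_le_pow_left₀ zero_le
      (show ‖a - c‖₊ ≤ ‖a - b‖₊ + ‖b - c‖₊ from norm_sub_le_norm_sub_add_norm_sub a b c) 2).trans add_sq_le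
  simp only [enorm_eq_nnnorm]
  exact_mod_cast h

/-- Jensen's inequality for the square, on a probability space. -/
theorem sq_lintegral_le_lintegral_sq {α : Type*} [MeasurableSpace α] {μ : Measure α}
    [IsProbabilityMeasure μ] {f : α → ℝ≥0∞} (hf : AEMeasurable f μ) :
    (∫⁻ a, f a ∂μ) ^ 2 ≤ ∫⁻ a, f a ^ 2 ∂μ := by
  have h := ENNReal.lintegral_mul_le_Lp_mul_Lq μ Real.HolderConjugate.two_two hf
    (aemeasurable_const (b := (1 : ℝ≥0∞)))
  simp only [Pi.mul_apply, mul_one, ENNReal.one_rpow, lintegral_const, measure_univ] at h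
  calc (∫⁻ a, f a ∂μ) ^ 2 ≤ ((∫⁻ a, f a ^ (2 : ℝ) ∂μ) ^ (1 / (2 : ℝ))) ^ 2 :=
        pow_le_pow_left₀ zero_le h 2
    _ = ∫⁻ a, f a ^ 2 ∂μ := by
        rw [← ENNReal.rpow_two, ← ENNReal.rpow_mul]
        simp

/-- The increment of a `C¹` function, squared, is controlled by the derivative on the segment. -/
theorem enorm_sub_sq_le_lintegral_fderiv {v : E N → E N} (hv : ContDiff ℝ 1 v) (y z : E N) :
    ‖v (y + z) - v y‖ₑ ^ 2 ≤
      ‖z‖ₑ ^ 2 * ∫⁻ t in Icc (0 : ℝ) 1, ‖fderiv ℝ v (y + t • z)‖ₑ ^ 2 := by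
  have hDc : Continuous (fderiv ℝ v) := hv.continuous_fderiv (by simp)
  have hcont : Continuous fun t : ℝ => fderiv ℝ v (y + t • z) := by fun_prop
  have hderiv : ∀ t : ℝ, HasDerivAt (fun t : ℝ => v (y + t • z)) (fderiv ℝ v (y + t • z) z) t := by
    intro t
    have h1 : HasDerivAt (fun t : ℝ => y + t • z) z t := by
      simpa using ((hasDerivAt_id t).smul_const z).const_add y
    exact ((hv.differentiable (by simp)) _).hasFDerivAt.comp_hasDerivAt t h1
  have hint := intervalIntegral.integral_eq_sub_of_hasDerivAt (a := 0) (b := 1)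
    (fun t _ => hderiv t) ((hcont.clm_apply continuous_const).intervalIntegrable 0 1)
  simp only [one_smul, zero_smul, add_zero] at hint
  have hprob : IsProbabilityMeasure ((volume : Measure ℝ).restrict (Icc 0 1)) := ⟨by simp⟩
  have hle : ‖v (y + z) - v y‖ₑ ≤ ‖z‖ₑ * ∫⁻ t in Icc (0 : ℝ) 1, ‖fderiv ℝ v (y + t • z)‖ₑ := by
    rw [← hint, intervalIntegral.integral_of_le zero_le_one, ← integral_Icc_eq_integral_Ioc,
      ← lintegral_const_mul' _ _ enorm_ne_top]
    refine (enorm_integral_le_lintegral_enorm _).trans (lintegral_mono fun t => ?_)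
    rw [mul_comm]
    exact ContinuousLinearMap.le_opENorm _ _
  calc ‖v (y + z) - v y‖ₑ ^ 2
      ≤ (‖z‖ₑ * ∫⁻ t in Icc (0 : ℝ) 1, ‖fderiv ℝ v (y + t • z)‖ₑ) ^ 2 :=
        pow_le_pow_left₀ zero_le hle 2
    _ ≤ _ := by
        rw [mul_pow]
        gcongr
        exact sq_lintegral_le_lintegral_sq hcont.enorm.aemeasurable

/-- If the translates `A + t z`, `0 ≤ t ≤ 1`, stay in `Ω`, then the increments of `v` along `z`
over `A` are controlled by the derivative on `Ω`. -/
theorem setLIntegral_increment_le {Ω A : Set (E N)} (hΩ : MeasurableSet Ω) (hA : MeasurableSet A)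
    {z : E N} (h : ∀ y ∈ A, ∀ t ∈ Icc (0 : ℝ) 1, y + t • z ∈ Ω)
    {v : E N → E N} (hv : ContDiff ℝ 1 v) :
    ∫⁻ y in A, ‖v (y + z) - v y‖ₑ ^ 2 ≤ ‖z‖ₑ ^ 2 * ∫⁻ x in Ω, ‖fderiv ℝ v x‖ₑ ^ 2 := by
  have hDc : Continuous (fderiv ℝ v) := hv.continuous_fderiv (by simp)
  calc ∫⁻ y in A, ‖v (y + z) - v y‖ₑ ^ 2
      ≤ ∫⁻ y in A, ‖z‖ₑ ^ 2 * ∫⁻ t in Icc (0 : ℝ) 1, ‖fderiv ℝ v (y + t • z)‖ₑ ^ 2 :=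
        lintegral_mono fun y => enorm_sub_sq_le_lintegral_fderiv hv y z
    _ = ‖z‖ₑ ^ 2 * ∫⁻ y in A, ∫⁻ t in Icc (0 : ℝ) 1, ‖fderiv ℝ v (y + t • z)‖ₑ ^ 2 :=
        lintegral_const_mul' _ _ (by simp)
    _ = ‖z‖ₑ ^ 2 * ∫⁻ t in Icc (0 : ℝ) 1, ∫⁻ y in A, ‖fderiv ℝ v (y + t • z)‖ₑ ^ 2 := by
        congr 1
        refine lintegral_lintegral_swap (Continuous.aemeasurable ?_)
        exact (ENNReal.continuous_pow 2).comp (Continuous.enorm (hDc.comp (by fun_prop)))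
    _ ≤ ‖z‖ₑ ^ 2 * ∫⁻ t in Icc (0 : ℝ) 1, ∫⁻ x in Ω, ‖fderiv ℝ v x‖ₑ ^ 2 := by
        gcongr ‖z‖ₑ ^ 2 * ?_
        refine setLIntegral_mono' measurableSet_Icc fun t ht => ?_
        -- For fixed `t`, translation by `t • z` preserves volume and carries `A` into `Ω`.
        rw [← lintegral_indicator hA, ← lintegral_indicator hΩ,
          ← lintegral_add_right_eq_self (Ω.indicator _) (t • z)]
        refine lintegral_mono fun y => ?_
        by_cases hy : y ∈ A
        · rw [indicator_of_mem hy, indicator_of_mem (h y hy t ht)]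
        · simp [indicator_of_notMem hy]
    _ = _ := by simp

/-! ### Poincaré estimates on subsets: gluing and transport. -/

/-- On `A`, every `C¹` field is close to a constant, up to its derivative on `Ω`. -/
def PoincareOn (Ω A : Set (E N)) : Prop :=
  ∃ C : ℝ≥0, ∀ v : E N → E N, ContDiff ℝ 1 v →
    ∃ c : E N, ∫⁻ x in A, ‖v x - c‖ₑ ^ 2 ≤ C * ∫⁻ x in Ω, ‖fderiv ℝ v x‖ₑ ^ 2

theorem PoincareOn.mono {Ω A B : Set (E N)} (h : PoincareOn Ω B) (hAB : A ⊆ B) :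
    PoincareOn Ω A := by
  obtain ⟨C, hC⟩ := h
  refine ⟨C, fun v hv => ?_⟩
  obtain ⟨c, hc⟩ := hC v hv
  exact ⟨c, (lintegral_mono_set hAB).trans hc⟩

/-- On the overlap both constants approximate `v`. Since the overlap has positive measure, this
bounds their difference, and the constant of `A` then also serves on `B`. -/
theorem PoincareOn.union {Ω A B : Set (E N)} (hA : PoincareOn Ω A) (hB : PoincareOn Ω B)
    (hAB : volume (A ∩ B) ≠ 0) (hBfin : volume B ≠ ⊤) : PoincareOn Ω (A ∪ B) := by
  obtain ⟨C₁, h₁⟩ := hA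
  obtain ⟨C₂, h₂⟩ := hB
  have hm : volume (A ∩ B) ≠ ⊤ := measure_ne_top_of_subset inter_subset_right hBfin
  set m := (volume (A ∩ B)).toNNReal with hm'
  set b := (volume B).toNNReal with hb'
  have hmeq : volume (A ∩ B) = m := (ENNReal.coe_toNNReal hm).symm
  have hbeq : volume B = b := (ENNReal.coe_toNNReal hBfin).symm
  have hm0 : m ≠ 0 := by
    intro h0
    exact hAB (by rw [hmeq, h0]; rfl)
  -- `m⁻¹ * (2 * (C₁ + C₂))` bounds `‖c₂ - c₁‖²` (see `hdiff`). The factor `b` integrates it over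
  -- `B`, and the outer `2` comes from `enorm_sub_sq_le`.
  refine ⟨C₁ + 2 * (C₂ + b * (m⁻¹ * (2 * (C₁ + C₂)))), fun v hv => ?_⟩
  obtain ⟨c₁, hc₁⟩ := h₁ v hv
  obtain ⟨c₂, hc₂⟩ := h₂ v hv
  set D := ∫⁻ x in Ω, ‖fderiv ℝ v x‖ₑ ^ 2
  have hvc : Continuous v := hv.continuous
  have hmeas : ∀ c, Measurable fun x => ‖v x - c‖ₑ ^ 2 := fun c =>
    ((ENNReal.continuous_pow 2).comp (hvc.sub continuous_const).enorm).measurable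
  have hdiff : ‖c₂ - c₁‖ₑ ^ 2 ≤ (m⁻¹ : ℝ≥0) * (2 * (C₁ + C₂)) * D := by
    have h : ‖c₂ - c₁‖ₑ ^ 2 * m ≤ 2 * (C₁ + C₂) * D := by
      calc ‖c₂ - c₁‖ₑ ^ 2 * m = ∫⁻ x in A ∩ B, ‖c₂ - c₁‖ₑ ^ 2 := by
            rw [setLIntegral_const, hmeq]
        _ ≤ ∫⁻ x in A ∩ B, 2 * (‖v x - c₁‖ₑ ^ 2 + ‖v x - c₂‖ₑ ^ 2) := by
            refine lintegral_mono fun x => ?_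
            refine (enorm_sub_sq_le c₂ (v x) c₁).trans_eq ?_
            rw [enorm_sub_rev c₂, add_comm]
        _ = 2 * ((∫⁻ x in A ∩ B, ‖v x - c₁‖ₑ ^ 2) + ∫⁻ x in A ∩ B, ‖v x - c₂‖ₑ ^ 2) := by
            rw [lintegral_const_mul' _ _ (by simp), lintegral_add_left (hmeas c₁)]
        _ ≤ 2 * (C₁ * D + C₂ * D) := by
            gcongr
            · exact (lintegral_mono_set inter_subset_left).trans hc₁
            · exact (lintegral_mono_set inter_subset_right).trans hc₂
        _ = _ := by ring
    have h0 : (m : ℝ≥0∞) ≠ 0 := by exact_mod_cast hm0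
    rw [← ENNReal.le_div_iff_mul_le (Or.inl h0) (Or.inl ENNReal.coe_ne_top)] at h
    refine h.trans_eq ?_
    rw [ENNReal.div_eq_inv_mul, ENNReal.coe_inv hm0, mul_assoc, mul_assoc, mul_assoc]
  refine ⟨c₁, ?_⟩
  calc ∫⁻ x in A ∪ B, ‖v x - c₁‖ₑ ^ 2
      ≤ (∫⁻ x in A, ‖v x - c₁‖ₑ ^ 2) + ∫⁻ x in B, ‖v x - c₁‖ₑ ^ 2 := lintegral_union_le _ _ _
    _ ≤ C₁ * D + ∫⁻ x in B, 2 * (‖v x - c₂‖ₑ ^ 2 + ‖c₂ - c₁‖ₑ ^ 2) := by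
        gcongr with x
        exact enorm_sub_sq_le _ _ _
    _ = C₁ * D + 2 * ((∫⁻ x in B, ‖v x - c₂‖ₑ ^ 2) + b * ‖c₂ - c₁‖ₑ ^ 2) := by
        rw [lintegral_const_mul' _ _ (by simp), lintegral_add_left (hmeas c₂), setLIntegral_const,
          hbeq, mul_comm (b : ℝ≥0∞)]
    _ ≤ C₁ * D + 2 * (C₂ * D + b * ((m⁻¹ : ℝ≥0) * (2 * (C₁ + C₂)) * D)) := by gcongr
    _ = _ := by
        push_cast
        ring

/-- The Poincaré inequality propagates along a translation that stays in `Ω`. -/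
theorem PoincareOn.of_translate {Ω A B : Set (E N)} (hΩ : MeasurableSet Ω) (hA : MeasurableSet A)
    (hBm : MeasurableSet B) (hB : PoincareOn Ω B) {z : E N}
    (h : ∀ y ∈ A, ∀ t ∈ Icc (0 : ℝ) 1, y + t • z ∈ Ω) (hz : ∀ y ∈ A, y + z ∈ B) :
    PoincareOn Ω A := by
  obtain ⟨C, hC⟩ := hB
  refine ⟨2 * (‖z‖₊ ^ 2 + C), fun v hv => ?_⟩
  obtain ⟨c, hc⟩ := hC v hv
  set D := ∫⁻ x in Ω, ‖fderiv ℝ v x‖ₑ ^ 2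
  have hvc : Continuous v := hv.continuous
  refine ⟨c, ?_⟩
  calc ∫⁻ x in A, ‖v x - c‖ₑ ^ 2
      ≤ ∫⁻ x in A, 2 * (‖v (x + z) - v x‖ₑ ^ 2 + ‖v (x + z) - c‖ₑ ^ 2) := by
        refine lintegral_mono fun x => ?_
        rw [enorm_sub_rev (v (x + z)) (v x)]
        exact enorm_sub_sq_le _ _ _
    _ = 2 * ((∫⁻ x in A, ‖v (x + z) - v x‖ₑ ^ 2) + ∫⁻ x in A, ‖v (x + z) - c‖ₑ ^ 2) := by
        rw [lintegral_const_mul' _ _ (by simp), lintegral_add_left]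
        exact ((ENNReal.continuous_pow 2).comp (Continuous.enorm (by fun_prop))).measurable
    _ ≤ 2 * (‖z‖ₑ ^ 2 * D + ∫⁻ x in B, ‖v x - c‖ₑ ^ 2) := by
        gcongr 2 * (?_ + ?_)
        · exact setLIntegral_increment_le hΩ hA h hv
        · rw [← lintegral_indicator hA, ← lintegral_indicator hBm,
            ← lintegral_add_right_eq_self (B.indicator _) z]
          refine lintegral_mono fun y => ?_
          by_cases hy : y ∈ A
          · rw [indicator_of_mem hy, indicator_of_mem (hz y hy)]
          · simp [indicator_of_notMem hy]
    _ ≤ 2 * (‖z‖ₑ ^ 2 * D + C * D) := by gcongr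
    _ = _ := by
        push_cast
        rw [enorm_eq_nnnorm]
        ring

/-! ### Local estimates: balls, interior points, boundary points. -/

/-- The Poincaré inequality on a ball. -/
theorem poincareOn_ball {Ω : Set (E N)} (hΩ : MeasurableSet Ω) {p : E N} {r : ℝ} (hr : 0 < r)
    (hB : Metric.ball p r ⊆ Ω) : PoincareOn Ω (Metric.ball p r) := by
  set B := Metric.ball p r with hBdef
  have hBm : MeasurableSet B := measurableSet_ball
  have hb0 : volume B ≠ 0 := (Metric.measure_ball_pos volume p hr).ne'
  have hbfin : volume B ≠ ⊤ := measure_ball_lt_top.ne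
  set R : ℝ≥0 := (2 * r).toNNReal
  have hR : ∀ x ∈ B, ∀ y ∈ B, x - y ∈ Metric.ball (0 : E N) (2 * r) := by
    intro x hx y hy
    rw [mem_ball_zero_iff, ← dist_eq_norm]
    have := dist_triangle_right x y p
    have h1 : dist x p < r := hx
    have h2 : dist y p < r := hy
    linarith
  set Z := Metric.ball (0 : E N) (2 * r) with hZ
  have hZfin : volume Z ≠ ⊤ := measure_ball_lt_top.ne
  refine ⟨(volume Z / volume B).toNNReal * R ^ 2, fun v hv => ?_⟩
  set D := ∫⁻ x in Ω, ‖fderiv ℝ v x‖ₑ ^ 2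
  have hvc : Continuous v := hv.continuous
  have hmeas2 : Measurable fun q : E N × E N => ‖v q.1 - v q.2‖ₑ ^ 2 :=
    ((ENNReal.continuous_pow 2).comp (Continuous.enorm (by fun_prop))).measurable
  have hinner : Measurable fun y => ∫⁻ x in B, ‖v x - v y‖ₑ ^ 2 :=
    Measurable.lintegral_prod_left' (f := fun q : E N × E N => ‖v q.1 - v q.2‖ₑ ^ 2) hmeas2
  have hdouble : ∫⁻ y in B, ∫⁻ x in B, ‖v x - v y‖ₑ ^ 2 ≤ volume Z * (R ^ 2 * D) := by
    -- Substituting `x = z + y` turns the double integral into one over increments `z`. The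
    -- indicator keeps both endpoints in `B`, so the order of integration can be swapped over the
    -- whole space.
    set g : E N → E N → ℝ≥0∞ := fun y z =>
      (B ×ˢ B).indicator (fun q : E N × E N => ‖v q.1 - v q.2‖ₑ ^ 2) (z + y, y) with hg
    have hgm : Measurable (Function.uncurry g) :=
      (hmeas2.indicator (hBm.prod hBm)).comp (by fun_prop)
    calc ∫⁻ y in B, ∫⁻ x in B, ‖v x - v y‖ₑ ^ 2
        = ∫⁻ y, ∫⁻ z, g y z := by
          rw [← lintegral_indicator hBm]
          refine lintegral_congr fun y => ?_
          by_cases hy : y ∈ B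
          · rw [indicator_of_mem hy, ← lintegral_indicator hBm,
              ← lintegral_add_right_eq_self _ y]
            refine lintegral_congr fun z => ?_
            by_cases hz : z + y ∈ B
            · simp [hg, hz, hy]
            · simp [hg, hz]
          · simp [hg, hy]
      _ = ∫⁻ z, ∫⁻ y, g y z := lintegral_lintegral_swap hgm.aemeasurable
      _ ≤ ∫⁻ z in Z, R ^ 2 * D := by
          rw [← lintegral_indicator measurableSet_ball]
          refine lintegral_mono fun z => ?_
          by_cases hz : z ∈ Z
          · rw [indicator_of_mem hz]
            set A := {y | y ∈ B ∧ z + y ∈ B} with hA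
            have hAm : MeasurableSet A :=
              hBm.inter ((measurable_const_add z) hBm)
            calc ∫⁻ y, g y z = ∫⁻ y in A, ‖v (y + z) - v y‖ₑ ^ 2 := by
                  rw [← lintegral_indicator hAm]
                  refine lintegral_congr fun y => ?_
                  by_cases hy : y ∈ A
                  · rw [indicator_of_mem hy, hg]
                    simp only
                    rw [indicator_of_mem (show (z + y, y) ∈ B ×ˢ B from ⟨hy.2, hy.1⟩), add_comm]
                  · rw [indicator_of_notMem hy, hg]
                    exact indicator_of_notMem (fun h => hy ⟨h.2, h.1⟩) _
              _ ≤ ‖z‖ₑ ^ 2 * D := by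
                  -- Both `y` and `y + z` lie in the ball, so by convexity the whole segment does.
                  refine setLIntegral_increment_le hΩ hAm (fun y hy t ht => hB ?_) hv
                  have := (convex_ball p r).add_smul_mem (x := y) (y := z) hy.1
                    (by rw [add_comm]; exact hy.2) ht
                  exact this
              _ ≤ R ^ 2 * D := by
                  gcongr
                  rw [enorm_eq_nnnorm]
                  have : ‖z‖₊ ≤ R := by
                    rw [Real.le_toNNReal_iff_coe_le (by positivity)]
                    exact (mem_ball_zero_iff.1 hz).le
                  exact_mod_cast this
          · rw [indicator_of_notMem hz, nonpos_iff_eq_zero, lintegral_eq_zero_iff']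
            · refine Eventually.of_forall fun y => indicator_of_notMem (fun h => hz ?_) _
              simpa using hR _ h.1 _ h.2
            · exact (hgm.comp (measurable_prodMk_right)).aemeasurable
      _ = volume Z * (R ^ 2 * D) := by rw [setLIntegral_const, mul_comm]
  -- Some `y` does no worse than the average, so `v y` serves as the constant in place of the mean
  -- of `v`.
  obtain ⟨y, -, hy⟩ := exists_le_setLAverage hb0 hbfin hinner.aemeasurable
  refine ⟨v y, hy.trans ?_⟩
  rw [setLAverage_eq]
  calc _ ≤ volume Z * (R ^ 2 * D) / volume B := by gcongr
    _ = _ := by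
      push_cast
      rw [ENNReal.coe_toNNReal (ENNReal.div_ne_top hZfin hb0), div_eq_mul_inv, div_eq_mul_inv]
      ring

theorem exists_poincareOn_ball_inter_of_mem {Ω : Set (E N)} (hΩ : IsOpen Ω) {p : E N}
    (hp : p ∈ Ω) : ∃ r > 0, PoincareOn Ω (Metric.ball p r ∩ Ω) := by
  obtain ⟨r, hr, hB⟩ := Metric.isOpen_iff.1 hΩ p hp
  exact ⟨r, hr, (poincareOn_ball hΩ.measurableSet hr hB).mono inter_subset_left⟩

/-- Near a boundary point, shift downwards into a ball inside `Ω`. -/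
theorem exists_poincareOn_ball_inter_of_mem_frontier {Ω : Set (E N)} (hΩ : IsOpen Ω)
    (hL : HasStrongLipschitzBoundary Ω) {p : E N} (hp : p ∈ frontier Ω) :
    ∃ r > 0, PoincareOn Ω (Metric.ball p r ∩ Ω) := by
  obtain ⟨U, hU, hpU, e, he, K, h, hh, hsub⟩ := hL p hp
  set P := (ℝ ∙ e)ᗮ.orthogonalProjectionOnto with hP
  have hPe : P e = 0 :=
    Submodule.orthogonalProjectionOnto_orthogonal_apply_eq_zero (Submodule.mem_span_singleton_self e)
  have hPs : ∀ (y : E N) (s : ℝ), P (y - s • e) = P y := by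
    intro y s
    rw [map_sub, map_smul, hPe, smul_zero, sub_zero]
  have hes : ∀ (y : E N) (s : ℝ), ⟪e, y - s • e⟫_ℝ = ⟪e, y⟫_ℝ - s := by
    intro y s
    rw [inner_sub_right, inner_smul_right, real_inner_self_eq_norm_sq, he]
    ring
  -- As a limit of points of `Ω`, `p` is on or below the graph; any positive shift along `-e` then
  -- puts it strictly below.
  have hple : ⟪e, p⟫_ℝ ≤ h (P p) := by
    have hcl : p ∈ closure (U ∩ Ω) :=
      hU.inter_closure ⟨hpU, frontier_subset_closure hp⟩
    have hclosed : IsClosed {y : E N | ⟪e, y⟫_ℝ ≤ h (P y)} :=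
      isClosed_le (by fun_prop) (hh.continuous.comp P.continuous)
    exact closure_minimal (fun y hy => ((hsub y hy.1).1 hy.2).le) hclosed hcl
  obtain ⟨ρ, hρ, hρU⟩ := Metric.isOpen_iff.1 hU p hpU
  -- Half of `ρ`, so that points within `s` of `p` stay in `U` when lowered by at most `s`.
  set s := ρ / 2 with hs
  have hs0 : 0 < s := by positivity
  have hmemU : ∀ y ∈ Metric.ball p s, ∀ τ ∈ Icc 0 s, y - τ • e ∈ U := by
    intro y hy τ hτ
    apply hρU
    rw [Metric.mem_ball, dist_eq_norm] at hy ⊢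
    calc ‖y - τ • e - p‖ = ‖(y - p) - τ • e‖ := by congr 1; abel
      _ ≤ ‖y - p‖ + ‖τ • e‖ := norm_sub_le _ _
      _ = ‖y - p‖ + τ := by rw [norm_smul, he, mul_one, Real.norm_of_nonneg hτ.1]
      _ < ρ := by have := hτ.2; linarith
  have hq : p - s • e ∈ Ω := by
    rw [hsub _ (hmemU p (Metric.mem_ball_self hs0) s ⟨hs0.le, le_rfl⟩), hes]
    rw [hPs]
    linarith
  obtain ⟨r, hr, hB⟩ := Metric.isOpen_iff.1 hΩ _ hq
  -- The bound `s` keeps the vertical paths in `U`; the bound `r` makes the shifted piece land in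
  -- the interior ball.
  refine ⟨min r s, lt_min hr hs0, ?_⟩
  refine PoincareOn.of_translate (z := -(s • e)) hΩ.measurableSet
    (Metric.isOpen_ball.inter hΩ).measurableSet measurableSet_ball
    (poincareOn_ball hΩ.measurableSet hr hB) ?_ ?_
  · rintro y ⟨hy, hyΩ⟩ t ht
    have hys : y ∈ Metric.ball p s := Metric.ball_subset_ball (min_le_right _ _) hy
    have hts : t * s ∈ Icc 0 s :=
      ⟨mul_nonneg ht.1 hs0.le, mul_le_of_le_one_left hs0.le ht.2⟩
    have heq : y + t • -(s • e) = y - (t * s) • e := by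
      rw [smul_neg, smul_smul, sub_eq_add_neg]
    have hyU : y ∈ U := by simpa using hmemU y hys 0 ⟨le_rfl, hs0.le⟩
    have hylt := (hsub y hyU).1 hyΩ
    rw [heq, hsub _ (hmemU y hys _ hts), hes]
    rw [hPs]
    have := hts.1
    change _ < h (P y) at hylt
    linarith
  · rintro y ⟨hy, -⟩
    have hyr : y ∈ Metric.ball p r := Metric.ball_subset_ball (min_le_left _ _) hy
    rw [Metric.mem_ball] at hyr ⊢
    rwa [← sub_eq_add_neg, dist_sub_right]

/-! ### From local to global by connectedness. -/

/-- A connected finite union of open sets with a Poincaré inequality has a Poincaré inequality. -/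
theorem PoincareOn.of_finite_cover {Ω : Set (E N)} (hΩ : IsConnected Ω) (hfin : volume Ω ≠ ⊤)
    {ι : Type*} (t : Finset ι) (V : ι → Set (E N)) (hV : ∀ i, IsOpen (V i))
    (hVΩ : ∀ i, V i ⊆ Ω) (hP : ∀ i ∈ t, PoincareOn Ω (V i)) (hcov : Ω ⊆ ⋃ i ∈ t, V i) :
    PoincareOn Ω Ω := by
  classical
  let W : Finset ι → Set (E N) := fun s => ⋃ i ∈ s, V i
  have hW : ∀ s, IsOpen (W s) := fun s => isOpen_biUnion fun i _ => hV i
  -- A subfamily in `S` of largest cardinality cannot meet any remaining `V i`, since gluing would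
  -- enlarge it. Nonempty open overlaps have positive volume.
  let S := t.powerset.filter fun s => (W s).Nonempty ∧ PoincareOn Ω (W s)
  have hS : S.Nonempty := by
    obtain ⟨x, hx⟩ := hΩ.nonempty
    obtain ⟨i, hi, hxi⟩ := mem_iUnion₂.1 (hcov hx)
    refine ⟨{i}, Finset.mem_filter.2 ⟨by simpa using hi, ?_⟩⟩
    simpa [W] using ⟨⟨x, hxi⟩, hP i hi⟩
  obtain ⟨s, hs, hmax⟩ := S.exists_max_image Finset.card hS
  obtain ⟨hst, hne, hPs⟩ := Finset.mem_filter.1 hs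
  rw [Finset.mem_powerset] at hst
  have hdisj : ∀ i ∈ t, i ∉ s → Disjoint (W s) (V i) := by
    intro i hi his
    by_contra hnd
    rw [not_disjoint_iff_nonempty_inter] at hnd
    have hins : W (insert i s) = W s ∪ V i := by
      simp only [W, Finset.set_biUnion_insert, union_comm]
    have hmem : insert i s ∈ S := by
      refine Finset.mem_filter.2 ⟨Finset.mem_powerset.2 (Finset.insert_subset hi hst), ?_, ?_⟩
      · rw [hins]; exact hne.mono subset_union_left
      · rw [hins]
        exact hPs.union (hP i hi) (((hW s).inter (hV i)).measure_pos volume hnd).ne'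
          (measure_ne_top_of_subset (hVΩ i) hfin)
    have := hmax _ hmem
    rw [Finset.card_insert_of_notMem his] at this
    omega
  -- `W s` and `W (t \ s)` are disjoint open sets covering the connected set `Ω`, and `Ω` meets the
  -- first.
  have hsub : Ω ⊆ W s := by
    refine hΩ.isPreconnected.subset_left_of_subset_union (hW s) (hW (t \ s)) ?_ ?_ ?_
    · refine disjoint_iUnion₂_right.2 fun i hi => ?_
      rw [Finset.mem_sdiff] at hi
      exact hdisj i hi.1 hi.2
    · intro x hx
      obtain ⟨i, hi, hxi⟩ := mem_iUnion₂.1 (hcov hx)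
      by_cases his : i ∈ s
      · exact Or.inl (mem_iUnion₂.2 ⟨i, his, hxi⟩)
      · exact Or.inr (mem_iUnion₂.2 ⟨i, Finset.mem_sdiff.2 ⟨hi, his⟩, hxi⟩)
    · obtain ⟨x, hx⟩ := hne
      obtain ⟨i, -, hxi⟩ := mem_iUnion₂.1 hx
      exact ⟨x, hVΩ i hxi, hx⟩
  exact hPs.mono hsub

/-- The Poincaré inequality for smooth fields on a bounded Lipschitz domain. -/
theorem IsBoundedLipschitzDomain.poincareOn {Ω : Set (E N)} (hΩ : IsBoundedLipschitzDomain Ω) :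
    PoincareOn Ω Ω := by
  have hloc : ∀ p ∈ closure Ω, ∃ r > 0, PoincareOn Ω (Metric.ball p r ∩ Ω) := by
    intro p hp
    by_cases hpΩ : p ∈ Ω
    · exact exists_poincareOn_ball_inter_of_mem hΩ.isOpen hpΩ
    · refine exists_poincareOn_ball_inter_of_mem_frontier hΩ.isOpen hΩ.lipschitz ⟨hp, ?_⟩
      rwa [hΩ.isOpen.interior_eq]
  choose! r hr hPr using hloc
  obtain ⟨t, ht, hcov⟩ := hΩ.isBounded.isCompact_closure.elim_nhds_subcover
    (fun p => Metric.ball p (r p)) fun p hp => Metric.ball_mem_nhds p (hr p hp)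
  refine PoincareOn.of_finite_cover hΩ.isConnected hΩ.isBounded.measure_lt_top.ne t
    (fun p => Metric.ball p (r p) ∩ Ω) (fun p => Metric.isOpen_ball.inter hΩ.isOpen)
    (fun p => inter_subset_right) (fun p hp => hPr p (ht p hp)) fun x hx => ?_
  obtain ⟨p, hp, hxp⟩ := mem_iUnion₂.1 (hcov (subset_closure hx))
  exact mem_iUnion₂.2 ⟨p, hp, hxp, hx⟩

/-! ### An abstract Poincaré inequality modulo a finite-dimensional space -/

section Abstract

variable {X Y M : Type*} [NormedAddCommGroup X] [NormedSpace ℝ X] [CompleteSpace X]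
  [NormedAddCommGroup Y] [InnerProductSpace ℝ Y] [NormedAddCommGroup M] [NormedSpace ℝ M]

/-- Recording the `F`-component of `f x` next to `g x` gives a map bounded below on a complete
space, hence with closed range. Forgetting that component preserves closedness because `F` is
finite-dimensional. -/
theorem isClosed_range_of_norm_sub_starProjection_le (f : X →L[ℝ] Y) (g : X →L[ℝ] M)
    (F : Submodule ℝ Y) [FiniteDimensional ℝ F] {C : ℝ} (hC : 0 ≤ C)
    (hnorm : ∀ x, ‖x‖ ≤ ‖f x‖ + ‖g x‖)
    (hF : ∀ x, ‖f x - F.starProjection (f x)‖ ≤ C * ‖g x‖) :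
    IsClosed (range g) := by
  let Φ : X →L[ℝ] F × M := (F.orthogonalProjectionOnto ∘L f).prod g
  have hΦ : AntilipschitzWith (C + 2).toNNReal Φ := by
    refine Φ.antilipschitz_of_bound fun x => ?_
    -- In `C + 2`, `C` pays for the part of `f x` off `F`, and one unit each for its projection to
    -- `F` and for `g x`.
    rw [Real.coe_toNNReal _ (by positivity)]
    have h1 : ‖F.orthogonalProjectionOnto (f x)‖ ≤ ‖Φ x‖ := norm_fst_le (Φ x)
    have h2 : ‖g x‖ ≤ ‖Φ x‖ := norm_snd_le (Φ x)
    have h3 : ‖f x‖ ≤ ‖f x - F.starProjection (f x)‖ + ‖F.orthogonalProjectionOnto (f x)‖ := by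
      simpa using norm_add_le (f x - F.starProjection (f x)) (F.starProjection (f x))
    nlinarith [hnorm x, hF x, norm_nonneg (g x)]
  have hT : IsClosed (Φ.range : Set (F × M)) := by
    have h := hΦ.isClosed_range Φ.uniformContinuous
    exact h
  let F₀ : Submodule ℝ (F × M) := LinearMap.range (LinearMap.inl ℝ F M)
  have hsup : IsClosed ((Φ.range ⊔ F₀ : Submodule ℝ (F × M)) : Set (F × M)) :=
    Submodule.isClosed_sup_finiteDimensional _ _ hT
  -- `F₀` is the kernel of `Prod.snd`, so adding it saturates `Φ.range`; closedness then descends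
  -- along the quotient map.
  have heq : (Prod.snd : F × M → M) ⁻¹' range g = (Φ.range ⊔ F₀ : Submodule ℝ (F × M)) := by
    ext ⟨a, m⟩
    simp only [mem_preimage, mem_range, SetLike.mem_coe, Submodule.mem_sup]
    constructor
    · rintro ⟨x, rfl⟩
      refine ⟨Φ x, ⟨x, rfl⟩, (a - F.orthogonalProjectionOnto (f x), 0), ⟨_, rfl⟩, ?_⟩
      simp [Φ]
    · rintro ⟨_, ⟨x, rfl⟩, _, ⟨b, rfl⟩, h⟩
      exact ⟨x, by simpa [Φ] using congrArg Prod.snd h⟩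
  rwa [← heq, isQuotientMap_snd.isClosed_preimage] at hsup

/-- Restricted to the `x` with `f x ∈ Kᗮ`, `g` loses its kernel but none of its range, so the closed
range gives a bounded inverse. -/
theorem exists_norm_le_of_norm_sub_starProjection_le [CompleteSpace M]
    (f : X →L[ℝ] Y) (g : X →L[ℝ] M)
    (F K : Submodule ℝ Y) [FiniteDimensional ℝ F] {C : ℝ} (hC : 0 ≤ C)
    (hnorm : ∀ x, ‖x‖ ≤ ‖f x‖ + ‖g x‖)
    (hF : ∀ x, ‖f x - F.starProjection (f x)‖ ≤ C * ‖g x‖)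
    (hg : ∀ x, f x ∈ F → g x = 0) (hK : K = f.range ⊓ F) :
    ∃ c : ℝ, 0 < c ∧ ∀ x, f x ∈ Kᗮ → ‖f x‖ ≤ c * ‖g x‖ := by
  have hKF : K ≤ F := hK ▸ inf_le_right
  have : FiniteDimensional ℝ K := Submodule.finiteDimensional_of_le hKF
  let S : Submodule ℝ X := Kᗮ.comap (f : X →ₗ[ℝ] Y)
  have hSc : IsClosed (S : Set X) := K.isClosed_orthogonal.preimage f.continuous
  have : CompleteSpace S := hSc.completeSpace_coe
  let gS : S →L[ℝ] M := g ∘L S.subtypeL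
  have hinj : Function.Injective gS := by
    rw [injective_iff_map_eq_zero]
    rintro ⟨x, hx⟩ hgx
    have hgx' : g x = 0 := hgx
    have h1 : f x - F.starProjection (f x) = 0 := by
      have := hF x
      rw [hgx', norm_zero, mul_zero] at this
      exact norm_le_zero_iff.1 this
    have hmem : f x ∈ F := by
      rw [sub_eq_zero.1 h1]
      exact F.starProjection_apply_mem _
    have hxK : f x ∈ K := by
      rw [hK]
      exact ⟨⟨x, rfl⟩, hmem⟩
    have hfx : f x = 0 := inner_self_eq_zero.1 (K.inner_right_of_mem_orthogonal hxK hx)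
    have := hnorm x
    rw [hfx, hgx', norm_zero, norm_zero, add_zero] at this
    exact Subtype.ext (norm_le_zero_iff.1 this)
  -- The `K`-component of `f x` is some `f u` with `f u ∈ F`; since `g u = 0`, replacing `x` by `x -
  -- u` leaves `g x` unchanged.
  have hrange : range gS = range g := by
    apply subset_antisymm
    · rintro _ ⟨x, rfl⟩
      exact ⟨x, rfl⟩
    · rintro _ ⟨x, rfl⟩
      have hk : K.starProjection (f x) ∈ K := K.starProjection_apply_mem _
      obtain ⟨⟨u, hu⟩, huF⟩ : K.starProjection (f x) ∈ f.range ⊓ F := hK ▸ hk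
      have hu' : f u = K.starProjection (f x) := hu
      refine ⟨⟨x - u, ?_⟩, ?_⟩
      · change f (x - u) ∈ Kᗮ
        rw [map_sub, hu']
        exact K.sub_starProjection_mem_orthogonal _
      · change g (x - u) = g x
        rw [map_sub, hg u (hu' ▸ huF), sub_zero]
  obtain ⟨k, hk⟩ := gS.antilipschitz_of_injective_of_isClosed_range hinj
    (hrange ▸ isClosed_range_of_norm_sub_starProjection_le f g F hC hnorm hF)
  -- The `+ 1` only makes the constant strictly positive.
  refine ⟨‖f‖ * k + 1, by positivity, fun x hx => ?_⟩
  have h1 : ‖x‖ ≤ k * ‖g x‖ := by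
    have h := hk.le_mul_dist (⟨x, hx⟩ : S) 0
    rwa [map_zero, dist_zero_right, dist_zero_right] at h
  calc ‖f x‖ ≤ ‖f‖ * ‖x‖ := f.le_opNorm x
    _ ≤ ‖f‖ * (k * ‖g x‖) := by gcongr
    _ ≤ (‖f‖ * k + 1) * ‖g x‖ := by nlinarith [norm_nonneg (g x)]

end Abstract

/-! ### The Sobolev space -/

/-- The coordinate pairing of an `L²` field with a square-integrable function is continuous. -/
theorem continuous_integral_coord_mul {ι : Type} [Fintype ι] {μ : Measure (E N)} (k : ι)
    {g : E N → ℝ} (hg : MemLp g 2 μ) :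
    Continuous fun f : Lp (EuclideanSpace ℝ ι) 2 μ => ∫ x, f x k * g x ∂μ := by
  classical
  have hG : MemLp (fun x => g x • EuclideanSpace.single k (1 : ℝ)) 2 μ :=
    hg.continuousLinearMap_comp
      ((ContinuousLinearMap.id ℝ ℝ).smulRight (EuclideanSpace.single k (1 : ℝ)))
  have heq : (fun f : Lp (EuclideanSpace ℝ ι) 2 μ => ∫ x, f x k * g x ∂μ) =
      fun f => ⟪hG.toLp _, f⟫_ℝ := by
    funext f
    rw [L2.inner_def]
    refine integral_congr_ae ?_
    filter_upwards [hG.coeFn_toLp] with x hx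
    rw [hx, real_inner_smul_left, EuclideanSpace.inner_single_left]
    simp [mul_comm]
  rw [heq]
  fun_prop

/-- Each test function imposes an equality between L²-continuous functionals. The resulting
completeness of `H1`, and so of `H1tn`, is what the closed-range argument needs. -/
theorem isClosed_H1 (Ω : Set (E N)) :
    IsClosed (H1 Ω : Set (WithLp 2 (L2Vec Ω × L2Mat Ω))) := by
  have : (H1 Ω : Set (WithLp 2 (L2Vec Ω × L2Mat Ω))) =
      ⋂ (φ : E N → ℝ) (_ : IsTestFunction Ω φ) (i : Fin N) (j : Fin N),
        {w | ∫ x in Ω, w.fst x j * partialDeriv i φ x = -∫ x in Ω, w.snd x (i, j) * φ x} := by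
    ext w
    simp only [mem_iInter, mem_ofPred_eq]
    rfl
  rw [this]
  refine isClosed_iInter fun φ => isClosed_iInter fun hφ => isClosed_iInter fun i =>
    isClosed_iInter fun j => isClosed_eq ?_ ?_
  · exact (continuous_integral_coord_mul j (hφ.memLp_partialDeriv i)).comp
      (WithLp.prod_continuous_ofLp 2 _ _).fst
  · exact ((continuous_integral_coord_mul (i, j) hφ.memLp).comp
      (WithLp.prod_continuous_ofLp 2 _ _).snd).neg

instance (Ω : Set (E N)) : CompleteSpace (H1 Ω) := (isClosed_H1 Ω).completeSpace_coe

instance (Ω Γt : Set (E N)) : CompleteSpace (H1tn Ω Γt) :=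
  (testFields Ω Γt).isClosed_topologicalClosure.completeSpace_coe

theorem continuous_field (Ω : Set (E N)) : Continuous (field Ω) :=
  (WithLp.prod_continuous_ofLp 2 (L2Vec Ω) (L2Mat Ω)).fst.comp continuous_subtype_val

theorem continuous_grad (Ω : Set (E N)) : Continuous (grad Ω) :=
  (WithLp.prod_continuous_ofLp 2 (L2Vec Ω) (L2Mat Ω)).snd.comp continuous_subtype_val

theorem H1.norm_le {Ω : Set (E N)} (w : H1 Ω) : ‖w‖ ≤ ‖field Ω w‖ + ‖grad Ω w‖ := by
  have h : ‖w‖ ^ 2 = ‖field Ω w‖ ^ 2 + ‖grad Ω w‖ ^ 2 := WithLp.prod_norm_sq_eq_of_L2 w.1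
  refine (sq_le_sq₀ (by positivity) (by positivity)).1 ?_
  rw [h]
  nlinarith [norm_nonneg (field Ω w), norm_nonneg (grad Ω w)]

/-- The weak gradient of a smooth field is its classical gradient. -/
theorem grad_ae_eq_fderiv {Ω : Set (E N)} (hΩ : IsOpen Ω) (hb : Bornology.IsBounded Ω)
    {w : H1 Ω} {v : E N → E N} (hv : ContDiff ℝ ∞ v)
    (hwv : field Ω w =ᵐ[volume.restrict Ω] v) (i j : Fin N) :
    ∀ᵐ x ∂volume.restrict Ω,
      grad Ω w x (i, j) = fderiv ℝ v x (EuclideanSpace.single i 1) j := by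
  have : IsFiniteMeasure (volume.restrict Ω) := ⟨by simpa using hb.measure_lt_top⟩
  set D : E N → ℝ := fun x => fderiv ℝ v x (EuclideanSpace.single i 1) j with hD
  have hvj : ContDiff ℝ ∞ fun x => v x j := (EuclideanSpace.proj (𝕜 := ℝ) j).contDiff.comp hv
  have hDeq : ∀ x, fderiv ℝ (fun x => v x j) x (EuclideanSpace.single i 1) = D x := by
    intro x
    have h := (EuclideanSpace.proj (𝕜 := ℝ) j).hasFDerivAt.comp x
      ((hv.differentiable (by simp)) x).hasFDerivAt
    have h' : HasFDerivAt (fun x => v x j) _ x := h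
    rw [h'.fderiv]
    rfl
  have hDc : Continuous D := by
    have : Continuous fun x => fderiv ℝ (fun x => v x j) x (EuclideanSpace.single i 1) :=
      (hvj.continuous_fderiv (by simp)).clm_apply continuous_const
    simpa only [hDeq] using this
  have hGi : Integrable (fun x => grad Ω w x (i, j)) (volume.restrict Ω) :=
    ((Lp.memLp (grad Ω w)).continuousLinearMap_comp
      (EuclideanSpace.proj (𝕜 := ℝ) (i, j))).integrable (by norm_num)
  have hloc : LocallyIntegrableOn (fun x => grad Ω w x (i, j) - D x) Ω volume :=
    (IntegrableOn.locallyIntegrableOn hGi).sub (hDc.locallyIntegrable.locallyIntegrableOn _)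
  -- The weak and the classical derivative satisfy the same integration by parts against every test
  -- function, so their difference vanishes a.e. As `φ` is supported in `Ω`, integrals over `Ω` and
  -- over the whole space agree.
  have hzero := hΩ.ae_eq_zero_of_integral_contDiff_smul_eq_zero hloc fun φ hφ hφc hφs => by
    have hφt : IsTestFunction Ω φ := ⟨hφ, hφc, hφs⟩
    have hφ0 : ∀ x, x ∉ Ω → φ x = 0 := fun x hx =>
      image_eq_zero_of_notMem_tsupport fun h => hx (hφs h)
    have hdφ0 : ∀ x, x ∉ Ω → partialDeriv i φ x = 0 := fun x hx => by
      rw [partialDeriv, fderiv_of_notMem_tsupport (𝕜 := ℝ) fun h => hx (hφs h)]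
      rfl
    have hdφc : Continuous (partialDeriv i φ) :=
      (hφ.continuous_fderiv (by simp)).clm_apply continuous_const
    have hdφs : HasCompactSupport (partialDeriv i φ) := hφc.fderiv_apply ℝ _
    have hDφ : Integrable (fun x => D x * φ x) :=
      (hDc.mul hφ.continuous).integrable_of_hasCompactSupport hφc.mul_left
    have hparts : ∫ x, v x j * partialDeriv i φ x = -∫ x, D x * φ x := by
      have h := integral_mul_fderiv_eq_neg_fderiv_mul_of_integrable (μ := (volume : Measure (E N)))
        (f := fun x => v x j) (g := φ) (v := EuclideanSpace.single i 1)
        (by simpa only [hDeq] using hDφ)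
        ((hvj.continuous.mul hdφc).integrable_of_hasCompactSupport hdφs.mul_left)
        ((hvj.continuous.mul hφ.continuous).integrable_of_hasCompactSupport hφc.mul_left)
        (fun x _ => (hvj.differentiable (by simp)) x)
        (fun x _ => (hφ.differentiable (by simp)) x)
      simp only [hDeq] at h
      exact h
    have hweak : ∫ x in Ω, field Ω w x j * partialDeriv i φ x =
        -∫ x in Ω, grad Ω w x (i, j) * φ x := w.2 φ hφt i j
    have h1 : ∫ x in Ω, field Ω w x j * partialDeriv i φ x = -∫ x in Ω, D x * φ x := by
      rw [setIntegral_eq_integral_of_forall_compl_eq_zero (f := fun x => D x * φ x)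
        fun x hx => by simp [hφ0 x hx], ← hparts,
        ← setIntegral_eq_integral_of_forall_compl_eq_zero (s := Ω)
          (f := fun x => v x j * partialDeriv i φ x) fun x hx => by simp [hdφ0 x hx]]
      refine integral_congr_ae ?_
      filter_upwards [hwv] with x hx
      rw [hx]
    have h2 : ∫ x in Ω, grad Ω w x (i, j) * φ x = ∫ x in Ω, D x * φ x :=
      neg_injective (hweak.symm.trans h1)
    rw [← setIntegral_eq_integral_of_forall_compl_eq_zero (s := Ω)
      fun x hx => by simp [hφ0 x hx]]
    have h3 : (fun x => φ x • (grad Ω w x (i, j) - D x)) =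
        fun x => grad Ω w x (i, j) * φ x - D x * φ x := by
      funext x
      rw [smul_eq_mul]
      ring
    rw [h3, integral_sub (integrable_coord_mul _ _ hφt.memLp) hDφ.integrableOn, h2, sub_self]
  rw [ae_restrict_iff' hΩ.measurableSet]
  filter_upwards [hzero] with x hx hxΩ
  exact sub_eq_zero.1 (hx hxΩ)

/-- The operator norm is bounded by the Frobenius norm. -/
theorem norm_le_of_forall_single (L : E N →L[ℝ] E N) (G : Mat N)
    (h : ∀ i j, G (i, j) = L (EuclideanSpace.single i 1) j) : ‖L‖ ≤ ‖G‖ := by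
  refine L.opNorm_le_bound (norm_nonneg _) fun u => ?_
  refine (sq_le_sq₀ (by positivity) (by positivity)).1 ?_
  have hu : ∀ j, L u j = ∑ i, u i * G (i, j) := by
    intro j
    have hsum : u = ∑ i, u i • EuclideanSpace.single i (1 : ℝ) := by
      ext k
      simp [Pi.single_apply]
    conv_lhs => rw [hsum]
    simp [h]
  rw [mul_pow, EuclideanSpace.real_norm_sq_eq, EuclideanSpace.real_norm_sq_eq G,
    EuclideanSpace.real_norm_sq_eq u, Fintype.sum_prod_type_right, Finset.sum_mul]
  refine Finset.sum_le_sum fun j _ => ?_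
  rw [hu, mul_comm]
  -- Cauchy–Schwarz for each output coordinate `j`.
  exact Finset.sum_mul_sq_le_sq_mul_sq _ _ _

theorem Lp_enorm_sq {α F : Type*} [MeasurableSpace α] [NormedAddCommGroup F] {μ : Measure α}
    (f : Lp F 2 μ) : ‖f‖ₑ ^ 2 = ∫⁻ x, ‖f x‖ₑ ^ 2 ∂μ := by
  rw [Lp.enorm_def, eLpNorm_eq_lintegral_rpow_enorm_toReal (by simp) (by simp), ← ENNReal.rpow_two,
    ← ENNReal.rpow_mul]
  simp

instance (Ω : Set (E N)) [IsFiniteMeasure (volume.restrict Ω)] :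
    FiniteDimensional ℝ (constFields Ω) := by
  refine Submodule.finiteDimensional_of_le
    (S₂ := LinearMap.range (Lp.constₗ 2 (volume.restrict Ω) ℝ : E N →ₗ[ℝ] L2Vec Ω)) ?_
  rintro f ⟨a, ha⟩
  exact ⟨a, Lp.ext ((Lp.coeFn_const _ _ a).trans ha.symm)⟩

/-- This is what allows constants to be subtracted without changing the gradient. -/
theorem grad_eq_zero_of_field_mem_constFields {Ω : Set (E N)} (hΩ : IsOpen Ω)
    (hb : Bornology.IsBounded Ω) {w : H1 Ω} (hw : field Ω w ∈ constFields Ω) : grad Ω w = 0 := by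
  obtain ⟨a, ha⟩ := hw
  have h := fun i j => grad_ae_eq_fderiv hΩ hb (contDiff_const (c := a)) ha i j
  simp only [← ae_all_iff] at h
  refine Lp.ext ?_
  filter_upwards [h, Lp.coeFn_zero (Mat N) 2 (volume.restrict Ω)] with x hx h0
  rw [h0]
  ext ⟨i, j⟩
  simpa using hx i j

/-- The Poincaré inequality on `H¹_{t,n}(Ω)` modulo constants. -/
theorem exists_norm_sub_starProjection_le {Ω : Set (E N)} (hΩ : IsBoundedLipschitzDomain Ω)
    (Γt : Set (E N)) [IsFiniteMeasure (volume.restrict Ω)] :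
    ∃ C : ℝ, 0 ≤ C ∧ ∀ w ∈ H1tn Ω Γt,
      ‖field Ω w - (constFields Ω).starProjection (field Ω w)‖ ≤ C * ‖grad Ω w‖ := by
  obtain ⟨C, hC⟩ := hΩ.poincareOn
  refine ⟨C.sqrt, NNReal.coe_nonneg _, fun w hw => ?_⟩
  have hclosed : IsClosed {w : H1 Ω |
      ‖field Ω w - (constFields Ω).starProjection (field Ω w)‖ ≤ C.sqrt * ‖grad Ω w‖} := by
    have h1 := continuous_field Ω
    have h2 := continuous_grad Ω
    exact isClosed_le (h1.sub ((constFields Ω).starProjection.continuous.comp h1)).norm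
      (continuous_const.mul h2.norm)
  -- Both sides are continuous on `H1`, so it suffices to treat restrictions of smooth test fields.
  refine closure_minimal ?_ hclosed hw
  rintro w ⟨v, hv, hwv⟩
  obtain ⟨c, hc⟩ := hC v (hv.smooth.of_le (by simp))
  set k : L2Vec Ω := Lp.const 2 (volume.restrict Ω) c with hk
  have hkm : k ∈ constFields Ω := ⟨c, Lp.coeFn_const _ _ c⟩
  -- The constant supplied by `PoincareOn` need not be optimal; the orthogonal projection does at
  -- least as well.
  have hmin : ‖field Ω w - (constFields Ω).starProjection (field Ω w)‖ ≤ ‖field Ω w - k‖ := by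
    rw [Submodule.starProjection_minimal]
    exact ciInf_le ⟨0, by rintro _ ⟨x, rfl⟩; exact norm_nonneg _⟩ (⟨k, hkm⟩ : constFields Ω)
  have hgrad : ∀ᵐ x ∂volume.restrict Ω, ‖fderiv ℝ v x‖ₑ ^ 2 ≤ ‖grad Ω w x‖ₑ ^ 2 := by
    have h := fun i j => grad_ae_eq_fderiv hΩ.isOpen hΩ.isBounded hv.smooth hwv i j
    simp only [← ae_all_iff] at h
    filter_upwards [h] with x hx
    gcongr
    exact enorm_le_iff_norm_le.2 (norm_le_of_forall_single _ _ hx)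
  have hsq : ‖field Ω w - k‖ₑ ^ 2 ≤ C * ‖grad Ω w‖ₑ ^ 2 := by
    rw [Lp_enorm_sq, Lp_enorm_sq]
    calc ∫⁻ x in Ω, ‖(field Ω w - k : L2Vec Ω) x‖ₑ ^ 2 = ∫⁻ x in Ω, ‖v x - c‖ₑ ^ 2 := by
          refine lintegral_congr_ae ?_
          filter_upwards [Lp.coeFn_sub (field Ω w) k, hwv,
            Lp.coeFn_const 2 (volume.restrict Ω) c] with x h1 h2 h3
          rw [h1, Pi.sub_apply, h2, hk, h3]
          rfl
      _ ≤ C * ∫⁻ x in Ω, ‖fderiv ℝ v x‖ₑ ^ 2 := hc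
      _ ≤ _ := by
          exact mul_le_mul_right (lintegral_mono_ae hgrad) _
  have hsq' : ‖field Ω w - k‖ ^ 2 ≤ C * ‖grad Ω w‖ ^ 2 := by
    have : ‖field Ω w - k‖₊ ^ 2 ≤ C * ‖grad Ω w‖₊ ^ 2 := by
      simp only [enorm_eq_nnnorm] at hsq
      exact_mod_cast hsq
    exact_mod_cast this
  refine hmin.trans ((sq_le_sq₀ (by positivity) (by positivity)).1 ?_)
  rw [mul_pow]
  have : (C.sqrt : ℝ) ^ 2 = C := by exact_mod_cast NNReal.sq_sqrt C
  rwa [this]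

end KornPoincare

end

/-! ### The abstract results applied to the embedding and the gradient on `H1tn`. -/

theorem mainTheorem9 (N : ℕ) (hN : 2 ≤ N) (Ω Γt : Set (KornPoincare.E N))
    (hΩ : KornPoincare.IsBoundedLipschitzDomain Ω)
    (hΓt : KornPoincare.IsRelOpenInBoundary Ω Γt) :
    (∃ c : ℝ, 0 < c ∧ ∀ v ∈ KornPoincare.H1tn Ω Γt,
      KornPoincare.field Ω v ∈ (KornPoincare.H1tnConst Ω Γt)ᗮ →
        ‖KornPoincare.field Ω v‖ ≤ c * ‖KornPoincare.grad Ω v‖) ∧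
    IsClosed (((KornPoincare.H1tn Ω Γt).map (KornPoincare.grad Ω) :
      Submodule ℝ (KornPoincare.L2Mat Ω)) : Set (KornPoincare.L2Mat Ω)) := by
  have : IsFiniteMeasure (volume.restrict Ω) := ⟨by simpa using hΩ.isBounded.measure_lt_top⟩
  obtain ⟨C, hC, hCle⟩ := KornPoincare.exists_norm_sub_starProjection_le hΩ Γt
  let f : KornPoincare.H1tn Ω Γt →L[ℝ] KornPoincare.L2Vec Ω :=
    ⟨KornPoincare.field Ω, KornPoincare.continuous_field Ω⟩ ∘L
      (KornPoincare.H1tn Ω Γt).subtypeL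
  let g : KornPoincare.H1tn Ω Γt →L[ℝ] KornPoincare.L2Mat Ω :=
    ⟨KornPoincare.grad Ω, KornPoincare.continuous_grad Ω⟩ ∘L
      (KornPoincare.H1tn Ω Γt).subtypeL
  have hnorm : ∀ x, ‖x‖ ≤ ‖f x‖ + ‖g x‖ := fun x => KornPoincare.H1.norm_le x.1
  have hF : ∀ x, ‖f x - (KornPoincare.constFields Ω).starProjection (f x)‖ ≤ C * ‖g x‖ :=
    fun x => hCle x.1 x.2
  have hpoincare := @KornPoincare.exists_norm_le_of_norm_sub_starProjection_le
    (KornPoincare.H1tn Ω Γt) (KornPoincare.L2Vec Ω) (KornPoincare.L2Mat Ω) _ _ _ _ _ _ _ _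
  have hclosed := @KornPoincare.isClosed_range_of_norm_sub_starProjection_le
    (KornPoincare.H1tn Ω Γt) (KornPoincare.L2Vec Ω) (KornPoincare.L2Mat Ω) _ _ _ _ _ _ _
  constructor
  · obtain ⟨c, hc, h⟩ := hpoincare f g (KornPoincare.constFields Ω) (KornPoincare.H1tnConst Ω Γt)
      hC hnorm hF
      (fun x hx => KornPoincare.grad_eq_zero_of_field_mem_constFields hΩ.isOpen hΩ.isBounded hx)
      (by
        rw [KornPoincare.H1tnConst]
        congr 1
        ext y
        exact ⟨fun ⟨x, hx, h⟩ => ⟨⟨x, hx⟩, h⟩, fun ⟨x, h⟩ => ⟨x.1, x.2, h⟩⟩)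
    exact ⟨c, hc, fun v hv hvK => h ⟨v, hv⟩ hvK⟩
  · have h := hclosed f g (KornPoincare.constFields Ω) hC hnorm hF
    convert h using 1
    ext y
    exact ⟨fun ⟨x, hx, h⟩ => ⟨⟨x, hx⟩, h⟩, fun ⟨x, h⟩ => ⟨x.1, x.2, h⟩⟩
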